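/- Let $H$ be an infinite-dimensional separable complex Hilbert space and let $A,B$ be bounded linear operators on $H$, where $A$ has finite rank $n=\operatorname{rank}(A)$. Write $\sigma(A)$ for the spectrum and $\rho(A)=\mathbb{C}\setminus\sigma(A)$ for the resolvent set of $A$, $\sigma_p(B)$ for the set of eigenvalues of $B$, $\|\cdot\|$ for the operator norm, and $d(z,\sigma(A))=\inf_{w\in\sigma(A)}|z-w|$. For a compact operator $T$ on $H$ let $\lambda_1(T),\lambda_2(T),\dots$ be its nonzero eigenvalues, repeated according to algebraic multiplicity and ordered so that $|\lambda_1(T)|\ge|\lambda_2(T)|\ge\cdots$, followed by zeros if there are only finitely many of them; let $s_k(T)=\sqrt{\lambda_k(T^*T)}$ be the singular values of $T$; and, if $\sum_k s_k(T)<\infty$, let $\det(I-T)=\prod_{k=1}^{\infty}(1-\lambda_k(T))$. Then for every $z\in\rho(A)\cap\sigma_p(B)$, \[ |\det(I-z^{-1}A)|\le\frac{\|A-B\|}{d(z,\sigma(A))}\prod_{k=1}^{n}\left(1+\frac{s_k(A)}{d(z,\sigma(A))}\right). \] (Since $\dim H=\infty$, $0\in\sigma(A)$, so $z\neq0$ and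 $d(z,\sigma(A))>0$.) -/

import Mathlib

namespace FiniteRankDet

variable {H : Type*} [NormedAddCommGroup H] [InnerProductSpace ℂ H]

/-- The algebraic multiplicity of `μ` as an eigenvalue of `T`: the dimension of the space of
generalized eigenvectors `⋃ k, ker (T - μ) ^ k` (it is `0` if `μ` is not an eigenvalue). For
compact `T` and `μ ≠ 0` this space is finite-dimensional. -/
noncomputable def algMult (T : H →L[ℂ] H) (μ : ℂ) : ℕ :=
  Module.finrank ℂ (Module.End.maxGenEigenspace (T : H →ₗ[ℂ] H) μ)

/-- `s 0, s 1, …` is an eigenvalue sequence of the compact operator `T`: the moduli decrease, and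
each nonzero number occurs exactly as often as its algebraic multiplicity says. If `T` has only
finitely many nonzero eigenvalues, all further terms are therefore `0`. -/
structure IsEigenvalueSeq (T : H →L[ℂ] H) (s : ℕ → ℂ) : Prop where
  antitone_norm : Antitone fun k => ‖s k‖
  encard_eq : ∀ μ : ℂ, μ ≠ 0 → {k | s k = μ}.encard = (algMult T μ : ℕ∞)

open Classical in
/-- The eigenvalue sequence of a compact operator, counted with algebraic multiplicities and
ordered by decreasing modulus, indexed from `0`. (Eigenvalues of equal modulus come in some
chosen order.) -/
noncomputable def eigenvalueSeq (T : H →L[ℂ] H) : ℕ → ℂ :=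
  if h : ∃ s, IsEigenvalueSeq T s then h.choose else 0

/-- The singular values `√(λ_k(T* T))` of a compact operator, in decreasing order, indexed from
`0`. The eigenvalues of `T* T` are nonnegative reals, so taking the real part only changes
the type. -/
noncomputable def singularValue [CompleteSpace H] (T : H →L[ℂ] H) (k : ℕ) : ℝ :=
  Real.sqrt (eigenvalueSeq (ContinuousLinearMap.adjoint T ∘L T) k).re

/-- The determinant `det (I - T) = ∏_k (1 - λ_k(T))` of a trace class operator `T`. -/
noncomputable def detOneSub (T : H →L[ℂ] H) : ℂ :=
  ∏' k : ℕ, (1 - eigenvalueSeq T k)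

theorem maxGenEigenspace_le_range (T : H →ₗ[ℂ] H) {μ : ℂ} (hμ : μ ≠ 0) :
    Module.End.maxGenEigenspace T μ ≤ LinearMap.range T := by
  intro x hx
  obtain ⟨k, hk⟩ := (Module.End.mem_maxGenEigenspace T μ x).1 hx
  clear hx
  induction k generalizing x with
  | zero => simp at hk; simp [hk]
  | succ k ih =>
    have h1 := ih (x := (T - μ • (1 : Module.End ℂ H)) x) (by rwa [pow_succ] at hk)
    have h2 : μ • x ∈ LinearMap.range T := by
      have : μ • x = T x - (T - μ • (1 : Module.End ℂ H)) x := by simp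
      rw [this]
      exact Submodule.sub_mem _ ⟨x, rfl⟩ h1
    exact (Submodule.smul_mem_iff _ hμ).1 h2

theorem finite_algMult_ne_zero (T : H →L[ℂ] H)
    [hT : FiniteDimensional ℂ (LinearMap.range (T : H →ₗ[ℂ] H))] :
    {μ : ℂ | μ ≠ 0 ∧ algMult T μ ≠ 0}.Finite := by
  set R := LinearMap.range (T : H →ₗ[ℂ] H) with hR
  let f : Module.End ℂ R := (T : H →ₗ[ℂ] H).restrict (p := R) (q := R) fun x _ => ⟨x, rfl⟩
  refine (Module.End.finite_hasEigenvalue f).subset ?_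
  rintro μ ⟨hμ, hm⟩
  have hne : Module.End.maxGenEigenspace (T : H →ₗ[ℂ] H) μ ≠ ⊥ := by
    intro h
    exact hm (by rw [algMult, h]; simp)
  have hev : Module.End.HasEigenvalue (T : H →ₗ[ℂ] H) μ := by
    by_contra hcon
    apply hne
    have h0 : Module.End.eigenspace (T : H →ₗ[ℂ] H) μ = ⊥ := by
      by_contra h'
      exact hcon h'
    rw [eq_bot_iff]
    intro x hx
    obtain ⟨k, hk⟩ := (Module.End.mem_maxGenEigenspace _ μ x).1 hx
    clear hx
    induction k generalizing x with
    | zero => simpa using hk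
    | succ k ih =>
      have h1 := ih (x := ((T : H →ₗ[ℂ] H) - μ • (1 : Module.End ℂ H)) x)
        (by rwa [pow_succ] at hk)
      have h2 : x ∈ Module.End.eigenspace (T : H →ₗ[ℂ] H) μ := by
        rw [Module.End.mem_eigenspace_iff]
        simpa [sub_eq_zero] using h1
      rwa [h0] at h2
  obtain ⟨x, hx⟩ := hev.exists_hasEigenvector
  have hxT : T x = μ • x := by simpa using hx.apply_eq_smul
  have hxR : x ∈ R := by
    rw [← Submodule.smul_mem_iff R hμ, ← hxT]
    exact ⟨x, rfl⟩
  refine Module.End.hasEigenvalue_of_hasEigenvector (x := (⟨x, hxR⟩ : R)) ?_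
  rw [Module.End.hasEigenvector_iff]
  refine ⟨Module.End.mem_eigenspace_iff.2 (Subtype.ext hxT), ?_⟩
  intro h
  exact hx.2 (congrArg Subtype.val h)

theorem list_getD_encard (L : List ℂ) {μ : ℂ} (hμ : μ ≠ 0) :
    {k | L.getD k 0 = μ}.encard = (L.count μ : ℕ∞) := by
  induction L with
  | nil => simp [hμ.symm]
  | cons a L ih =>
    have hs : {k | (a :: L).getD k 0 = μ} =
        (if a = μ then {0} else ∅) ∪ Nat.succ '' {k | L.getD k 0 = μ} := by
      ext k
      cases k with
      | zero => by_cases h : a = μ <;> simp [h]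
      | succ k => by_cases h : a = μ <;> simp [h]
    rw [hs, Set.encard_union_eq, Nat.succ_injective.encard_image, ih]
    · by_cases h : a = μ
      · simp [h, add_comm]
      · simp [h]
    · rw [Set.disjoint_left]
      by_cases h : a = μ <;> simp [h]

/-- An operator of finite rank has an eigenvalue sequence. -/
theorem exists_isEigenvalueSeq (T : H →L[ℂ] H)
    [FiniteDimensional ℂ (LinearMap.range (T : H →ₗ[ℂ] H))] : ∃ s, IsEigenvalueSeq T s := by
  classical
  let S := (finite_algMult_ne_zero T).toFinset
  let M : Multiset ℂ := ∑ μ ∈ S, Multiset.replicate (algMult T μ) μ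
  let r : ℂ → ℂ → Prop := fun a b => ‖b‖ ≤ ‖a‖
  have : Std.Total r := ⟨fun a b => le_total ‖b‖ ‖a‖⟩
  have : IsTrans ℂ r := ⟨fun a b c h1 h2 => le_trans h2 h1⟩
  let L := M.toList.insertionSort r
  have hL : L.Pairwise r := List.pairwise_insertionSort r _
  refine ⟨fun k => L.getD k 0, ?_, ?_⟩
  · intro i j hij
    rcases hij.eq_or_lt with rfl | hlt
    · exact le_rfl
    by_cases hj : j < L.length
    · have := List.pairwise_iff_getElem.1 hL i j (hlt.trans hj) hj hlt
      simpa [List.getD_eq_getElem, hj, hlt.trans hj] using this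
    · simp only [List.getD_eq_default L 0 (not_lt.1 hj), norm_zero]
      exact norm_nonneg _
  · intro μ hμ
    rw [list_getD_encard L hμ]
    congr 1
    rw [(List.perm_insertionSort r M.toList).count_eq, ← Multiset.coe_count, Multiset.coe_toList,
      Multiset.count_sum']
    simp only [Multiset.count_replicate]
    rw [Finset.sum_ite_eq']
    split_ifs with h
    · rfl
    · simp only [S, Set.Finite.mem_toFinset, Set.mem_ofPred_eq, not_and, not_not] at h
      exact (h hμ).symm

theorem isEigenvalueSeq_eigenvalueSeq (T : H →L[ℂ] H)
    [FiniteDimensional ℂ (LinearMap.range (T : H →ₗ[ℂ] H))] :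
    IsEigenvalueSeq T (eigenvalueSeq T) := by
  have h := exists_isEigenvalueSeq T
  rw [eigenvalueSeq, dif_pos h]
  exact h.choose_spec

end FiniteRankDet

/-! Put `S = 1 - z⁻¹ • A`. On a finite-dimensional `V` containing the range of `A`, the determinant
of `S` restricted to `V` is `detOneSub (z⁻¹ • A)`, and its modulus is the product of the singular
values of the restriction. A unit eigenvector `x` of `B` for `z` gives `S x = z⁻¹ • (B - A) x`, so
the smallest singular value is at most `‖A - B‖ / ‖z‖`. Since `‖S y‖ ≤ ‖y‖ + ‖A y‖ / ‖z‖`, a min-max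
argument bounds the `k`-th of the others by `1 + s_k(A) / ‖z‖`, which is `1` beyond the rank. Both
steps are in `norm_det_le_of_norm_le_add`. Finally `0 ∈ σ(A)` gives `d(z, σ(A)) ≤ ‖z‖`, so `‖z‖` may
be replaced by the distance. -/

namespace LinearMap

/-! ### Singular values and determinants in finite dimension. -/

open Module

variable {E F : Type*} [NormedAddCommGroup E] [InnerProductSpace ℂ E] [FiniteDimensional ℂ E]
  [NormedAddCommGroup F] [InnerProductSpace ℂ F] [FiniteDimensional ℂ F]

/-- An orthonormal basis of right singular vectors, in decreasing order of the singular values. -/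
noncomputable def singularBasis (T : E →ₗ[ℂ] F) : OrthonormalBasis (Fin (finrank ℂ E)) ℂ E :=
  T.isSymmetric_adjoint_comp_self.eigenvectorBasis rfl

theorem norm_apply_sq_eq_sum_singularValues (T : E →ₗ[ℂ] F) (y : E) :
    ‖T y‖ ^ 2 = ∑ i : Fin (finrank ℂ E), T.singularValues i ^ 2 * ‖T.singularBasis.repr y i‖ ^ 2 := by
  have h1 : ((‖T y‖ ^ 2 : ℝ) : ℂ) = inner ℂ y ((adjoint T ∘ₗ T) y) := by
    rw [comp_apply, adjoint_inner_right, inner_self_eq_norm_sq_to_K]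
    norm_cast
  have h2 : inner ℂ y ((adjoint T ∘ₗ T) y) =
      ((∑ i : Fin (finrank ℂ E), T.singularValues i ^ 2 * ‖T.singularBasis.repr y i‖ ^ 2 : ℝ) : ℂ) := by
    rw [← T.singularBasis.repr.inner_map_map, PiLp.inner_apply,
      Complex.ofReal_sum]
    refine Finset.sum_congr rfl fun i _ => ?_
    have h3 : T.singularBasis.repr ((adjoint T ∘ₗ T) y) i =
        ((T.singularValues i ^ 2 : ℝ) : ℂ) * T.singularBasis.repr y i := by
      rw [T.sq_singularValues_fin rfl]
      exact T.isSymmetric_adjoint_comp_self.eigenvectorBasis_apply_self_apply rfl y i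
    rw [h3, RCLike.inner_apply, mul_assoc, Complex.mul_conj, Complex.normSq_eq_norm_sq]
    push_cast
    rfl
  exact_mod_cast h1.trans h2

theorem norm_apply_le_singularValues_mul (T : E →ₗ[ℂ] F) {k : ℕ} {y : E}
    (hy : ∀ i : Fin (finrank ℂ E), i < k → T.singularBasis.repr y i = 0) :
    ‖T y‖ ≤ T.singularValues k * ‖y‖ := by
  refine le_of_sq_le_sq ?_ (mul_nonneg (T.singularValues_nonneg k) (norm_nonneg y))
  rw [T.norm_apply_sq_eq_sum_singularValues, mul_pow, ← T.singularBasis.repr.norm_map y,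
    EuclideanSpace.norm_sq_eq, Finset.mul_sum]
  refine Finset.sum_le_sum fun i _ => ?_
  by_cases hi : (i : ℕ) < k
  · simp [hy i hi]
  · have := T.singularValues_nonneg i
    have := T.singularValues_antitone (not_lt.1 hi)
    gcongr

theorem singularValues_mul_le_norm_apply (T : E →ₗ[ℂ] F) {k : ℕ} {y : E}
    (hy : ∀ i : Fin (finrank ℂ E), k < i → T.singularBasis.repr y i = 0) :
    T.singularValues k * ‖y‖ ≤ ‖T y‖ := by
  refine le_of_sq_le_sq ?_ (norm_nonneg _)
  rw [T.norm_apply_sq_eq_sum_singularValues, mul_pow, ← T.singularBasis.repr.norm_map y,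
    EuclideanSpace.norm_sq_eq, Finset.mul_sum]
  refine Finset.sum_le_sum fun i _ => ?_
  by_cases hi : k < (i : ℕ)
  · simp [hy i hi]
  · have := T.singularValues_nonneg k
    have := T.singularValues_antitone (not_lt.1 hi)
    gcongr

/-- Dimension count: no condition is imposed at index `k`, so there is one linear condition fewer
than the dimension. -/
theorem exists_ne_zero_repr_eq_zero (b c : OrthonormalBasis (Fin (finrank ℂ E)) ℂ E)
    {k : ℕ} (hk : k < finrank ℂ E) :
    ∃ y : E, y ≠ 0 ∧ (∀ i : Fin (finrank ℂ E), k < i → b.repr y i = 0) ∧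
      ∀ i : Fin (finrank ℂ E), i < k → c.repr y i = 0 := by
  let L : E →ₗ[ℂ] (Fin (finrank ℂ E) → ℂ) := LinearMap.pi fun i =>
    if k < i then b.toBasis.coord i else if i < k then c.toBasis.coord i else 0
  -- The `k`-th coordinate of `L` is identically `0`, so the constant vector `1` is not in its
  -- range.
  have hL : ¬ Function.Injective L := by
    rw [injective_iff_surjective_of_finrank_eq_finrank (by simp)]
    intro h
    obtain ⟨y, hy⟩ := h 1
    simpa [L] using congrFun hy ⟨k, hk⟩
  rw [← ker_eq_bot, Submodule.eq_bot_iff] at hL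
  push Not at hL
  obtain ⟨y, hy, hy0⟩ := hL
  have hLy (i) : L y i = 0 := by rw [mem_ker.1 hy]; rfl
  refine ⟨y, hy0, fun i hi => ?_, fun i hi => ?_⟩
  · simpa [L, hi] using hLy i
  · simpa [L, hi, hi.le.not_gt] using hLy i

/-- Test the hypothesis on a vector in the span of the first `k + 1` right singular vectors of `S`
and orthogonal to the first `k` of `T`. -/
theorem singularValues_le_one_add_mul {S T : E →ₗ[ℂ] E} {r : ℝ} (hr : 0 ≤ r)
    (h : ∀ y, ‖S y‖ ≤ ‖y‖ + r * ‖T y‖) (k : ℕ) :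
    S.singularValues k ≤ 1 + r * T.singularValues k := by
  by_cases hk : k < finrank ℂ E
  · obtain ⟨y, hy0, hyS, hyT⟩ := exists_ne_zero_repr_eq_zero S.singularBasis T.singularBasis hk
    refine le_of_mul_le_mul_right ?_ (norm_pos_iff.2 hy0)
    calc S.singularValues k * ‖y‖ ≤ ‖S y‖ := S.singularValues_mul_le_norm_apply hyS
      _ ≤ ‖y‖ + r * ‖T y‖ := h y
      _ ≤ ‖y‖ + r * (T.singularValues k * ‖y‖) := by
        gcongr
        exact T.norm_apply_le_singularValues_mul hyT
      _ = (1 + r * T.singularValues k) * ‖y‖ := by ring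
  · rw [S.singularValues_of_finrank_le (not_lt.1 hk)]
    have := T.singularValues_nonneg k
    positivity

theorem norm_det_eq_prod_singularValues (T : E →ₗ[ℂ] E) :
    ‖LinearMap.det T‖ = ∏ i ∈ Finset.range (finrank ℂ E), T.singularValues i := by
  rw [← T.normDet_eq_norm_det, T.normDet_eq_prod_singularValues]

/-- The smallest factor of the determinant of `S` is bounded by its value at a unit vector, and the
other ones by the singular values of `T`. -/
theorem norm_det_le_of_norm_le_add {S T : E →ₗ[ℂ] E} {r δ : ℝ} (hr : 0 ≤ r)
    (h : ∀ y, ‖S y‖ ≤ ‖y‖ + r * ‖T y‖) {x : E} (hx : ‖x‖ = 1) (hSx : ‖S x‖ ≤ δ) {n : ℕ}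
    (hn : finrank ℂ T.range ≤ n) :
    ‖LinearMap.det S‖ ≤ δ * ∏ k ∈ Finset.range n, (1 + r * T.singularValues k) := by
  have hx0 : x ≠ 0 := by
    rintro rfl
    simp at hx
  have : Nontrivial E := ⟨x, 0, hx0⟩
  obtain ⟨m, hm⟩ : ∃ m, finrank ℂ E = m + 1 :=
    Nat.exists_eq_succ_of_ne_zero (finrank_pos (R := ℂ) (M := E)).ne'
  have hfac (k : ℕ) : 1 ≤ 1 + r * T.singularValues k :=
    le_add_of_nonneg_right (mul_nonneg hr (T.singularValues_nonneg k))
  have hlast : S.singularValues m ≤ δ := by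
    -- Index `m` is the last one, so the vanishing condition on `x` is vacuous.
    have := S.singularValues_mul_le_norm_apply (k := m) (y := x) fun i hi => by omega
    rw [hx, mul_one] at this
    exact this.trans hSx
  have hprod : ∏ k ∈ Finset.range m, (1 + r * T.singularValues k) ≤
      ∏ k ∈ Finset.range n, (1 + r * T.singularValues k) := by
    -- `m` and `n` need not be comparable; the factors from the rank of `T` on equal `1`.
    calc _ ≤ ∏ k ∈ Finset.range (max m n), (1 + r * T.singularValues k) :=
          Finset.prod_le_prod_of_subset_of_one_le (by simp)
            (fun k _ => zero_le_one.trans (hfac k)) fun k _ _ => hfac k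
      _ = _ := by
        refine (Finset.prod_subset (by simp) fun k _ hk => ?_).symm
        rw [T.singularValues_eq_zero_iff_le_finrank_range.2
          (hn.trans (not_lt.1 (by simpa using hk)))]
        simp
  rw [S.norm_det_eq_prod_singularValues, hm, Finset.prod_range_succ, mul_comm]
  refine mul_le_mul hlast (le_trans ?_ hprod)
    (Finset.prod_nonneg fun k _ => S.singularValues_nonneg k)
    ((S.singularValues_nonneg m).trans hlast)
  exact Finset.prod_le_prod (fun k _ => S.singularValues_nonneg k)
    fun k _ => singularValues_le_one_add_mul hr h k

end LinearMap

/-! ### Eigenvalue sequences computed on a finite-dimensional subspace. -/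

namespace FiniteRankDet

open Module

variable {H : Type*} [NormedAddCommGroup H] [InnerProductSpace ℂ H]

theorem mapsTo_of_range_le {T : H →L[ℂ] H} {V : Submodule ℂ H}
    (hV : LinearMap.range (T : H →ₗ[ℂ] H) ≤ V) :
    ∀ x ∈ V, (T : H →ₗ[ℂ] H) x ∈ V := fun x _ => hV ⟨x, rfl⟩

/-- Generalized eigenvectors for `μ ≠ 0` lie in the range, hence in `V`, so restriction loses no
multiplicity. -/
theorem algMult_eq_count_roots {T : H →L[ℂ] H} {V : Submodule ℂ H} [FiniteDimensional ℂ V]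
    (hV : LinearMap.range (T : H →ₗ[ℂ] H) ≤ V) {μ : ℂ} (hμ : μ ≠ 0) :
    algMult T μ =
      ((T : H →ₗ[ℂ] H).restrict (mapsTo_of_range_le hV)).charpoly.roots.count μ := by
  rw [Polynomial.count_roots, ← LinearMap.finrank_maxGenEigenspace_eq, algMult]
  have h := Submodule.inf_genEigenspace (T : H →ₗ[ℂ] H) V (k := ⊤) (μ := μ) (mapsTo_of_range_le hV)
  rw [inf_eq_right.2 ((maxGenEigenspace_le_range (T : H →ₗ[ℂ] H) hμ).trans hV)] at h
  rw [h]
  exact Submodule.finrank_map_subtype_eq _ _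

theorem IsEigenvalueSeq.finite_support {T : H →L[ℂ] H}
    [FiniteDimensional ℂ (LinearMap.range (T : H →ₗ[ℂ] H))] {s : ℕ → ℂ}
    (hs : IsEigenvalueSeq T s) : {k | s k ≠ 0}.Finite := by
  have hfib (μ : ℂ) (hμ : μ ≠ 0) : {k | s k = μ}.Finite :=
    Set.finite_of_encard_eq_coe (hs.encard_eq μ hμ)
  refine ((finite_algMult_ne_zero T).biUnion fun μ hμ => hfib μ hμ.1).subset fun k hk => ?_
  refine Set.mem_biUnion (x := s k) ⟨hk, fun h0 => ?_⟩ rfl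
  have h1 := hs.encard_eq (s k) hk
  rw [h0, Nat.cast_zero, Set.encard_eq_zero] at h1
  exact (Set.eq_empty_iff_forall_notMem.1 h1 k) rfl

theorem IsEigenvalueSeq.card_filter {T : H →L[ℂ] H} {s : ℕ → ℂ} (hs : IsEigenvalueSeq T s)
    {F : Finset ℕ} (hF : ∀ k, s k ≠ 0 → k ∈ F) {μ : ℂ} (hμ : μ ≠ 0) :
    (F.filter fun k => s k = μ).card = algMult T μ := by
  have h : {k | s k = μ} = ((F.filter fun k => s k = μ : Finset ℕ) : Set ℕ) := by
    ext k
    simp only [Finset.coe_filter, Set.mem_ofPred_eq]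
    exact ⟨fun hk => ⟨hF k (hk ▸ hμ), hk⟩, fun hk => hk.2⟩
  have h1 := hs.encard_eq μ hμ
  rw [h, Set.encard_coe_eq_coe_finsetCard] at h1
  exact_mod_cast h1

/-- The right side is the characteristic polynomial of the restriction at `1`. Zero eigenvalues
contribute factors `1` on both sides, so only nonzero multiplicities must agree. -/
theorem IsEigenvalueSeq.tprod_one_sub {T : H →L[ℂ] H} {V : Submodule ℂ H} [FiniteDimensional ℂ V]
    (hV : LinearMap.range (T : H →ₗ[ℂ] H) ≤ V) {s : ℕ → ℂ} (hs : IsEigenvalueSeq T s) :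
    ∏' k, (1 - s k) =
      LinearMap.det (1 - (T : H →ₗ[ℂ] H).restrict (mapsTo_of_range_le hV)) := by
  classical
  have := Submodule.finiteDimensional_of_le hV
  set f := (T : H →ₗ[ℂ] H).restrict (mapsTo_of_range_le hV) with hf
  let F := hs.finite_support.toFinset
  have hF (k : ℕ) : s k ≠ 0 ↔ k ∈ F := by simp [F]
  have hdet : LinearMap.det (1 - f) = (f.charpoly.roots.map fun μ => 1 - μ).prod := by
    rw [← (IsAlgClosed.splits f.charpoly).eval_eq_prod_roots_of_monic f.charpoly_monic,
      LinearMap.eval_charpoly, map_one]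
  rw [tprod_eq_prod (s := F) fun k hk => by
      rw [not_not.1 (mt (hF k).1 hk), sub_zero], hdet,
    Finset.prod_comp (fun μ : ℂ => 1 - μ) s, Finset.prod_multiset_map_count]
  have hcount (μ : ℂ) (hμ : μ ≠ 0) :
      (F.filter fun k => s k = μ).card = f.charpoly.roots.count μ := by
    rw [hs.card_filter (fun k => (hF k).1) hμ, algMult_eq_count_roots hV hμ]
  have himage (μ : ℂ) (hμ : μ ∈ F.image s) : μ ≠ 0 := by
    obtain ⟨k, hk, rfl⟩ := Finset.mem_image.1 hμ
    exact (hF k).2 hk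
  have hsub : F.image s ⊆ f.charpoly.roots.toFinset := by
    intro μ hμ
    rw [Multiset.mem_toFinset, ← Multiset.count_pos, ← hcount μ (himage μ hμ), Finset.card_pos]
    obtain ⟨k, hk, rfl⟩ := Finset.mem_image.1 hμ
    exact ⟨k, by simp [hk]⟩
  rw [← Finset.prod_subset hsub]
  · exact Finset.prod_congr rfl fun μ hμ => by rw [hcount μ (himage μ hμ)]
  · intro μ _ hμ
    by_cases h0 : μ = 0
    · simp [h0]
    · rw [← hcount μ h0, Finset.card_eq_zero.2, pow_zero]
      refine Finset.filter_eq_empty_iff.2 fun k hk hkμ => hμ ?_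
      exact Finset.mem_image.2 ⟨k, hk, hkμ⟩

theorem detOneSub_eq_det_restrict {T : H →L[ℂ] H} {V : Submodule ℂ H} [FiniteDimensional ℂ V]
    (hV : LinearMap.range (T : H →ₗ[ℂ] H) ≤ V) :
    detOneSub T = LinearMap.det (1 - (T : H →ₗ[ℂ] H).restrict (mapsTo_of_range_le hV)) := by
  have := Submodule.finiteDimensional_of_le hV
  exact (isEigenvalueSeq_eigenvalueSeq T).tprod_one_sub hV

/-- The numbers `a 0 ≥ a 1 ≥ ⋯` are bounded by the moduli in an eigenvalue sequence of `T`, if each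
nonzero value occurs at most as often as its algebraic multiplicity says. -/
theorem IsEigenvalueSeq.le_norm_of_card_le {T : H →L[ℂ] H} {s : ℕ → ℂ} (hs : IsEigenvalueSeq T s)
    [FiniteDimensional ℂ (LinearMap.range (T : H →ₗ[ℂ] H))] {m : ℕ} {a : Fin m → ℝ}
    (ha : Antitone a)
    (hcard : ∀ α : ℝ, α ≠ 0 → (Finset.univ.filter fun i => a i = α).card ≤ algMult T α)
    (k : Fin m) : a k ≤ ‖s k‖ := by
  classical
  by_contra! hlt
  have hpos : 0 < a k := (norm_nonneg _).trans_lt hlt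
  let F := hs.finite_support.toFinset
  have hF (j : ℕ) (hj : s j ≠ 0) : j ∈ F := by simpa [F] using hj
  -- If `‖s k‖ < a k`, monotonicity puts all these indices below `k`, while counting multiplicities
  -- yields at least `k + 1` of them.
  let J := F.filter fun j => ∃ i ≤ k, s j = a i
  have hJ : J.card ≤ k := by
    rw [← Finset.card_range (k : ℕ)]
    refine Finset.card_le_card fun j hj => ?_
    obtain ⟨-, i, hi, hji⟩ := Finset.mem_filter.1 hj
    by_contra hjk
    have h1 := hs.antitone_norm (not_lt.1 (mt Finset.mem_range.2 hjk))
    simp only [hji, Complex.norm_real, Real.norm_eq_abs] at h1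
    exact absurd ((ha hi).trans ((le_abs_self _).trans h1)) (not_le.2 hlt)
  have hI : (Finset.Iic k).card ≤ J.card := by
    rw [Finset.card_eq_sum_card_image a (Finset.Iic k)]
    have hmaps : ∀ j ∈ J, (s j).re ∈ (Finset.Iic k).image a := by
      intro j hj
      obtain ⟨-, i, hi, hji⟩ := Finset.mem_filter.1 hj
      exact Finset.mem_image.2 ⟨i, Finset.mem_Iic.2 hi, by simp [hji]⟩
    rw [Finset.card_eq_sum_card_fiberwise hmaps]
    refine Finset.sum_le_sum fun α hα => ?_
    obtain ⟨i, hi, rfl⟩ := Finset.mem_image.1 hα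
    have hi := Finset.mem_Iic.1 hi
    have hi0 : a i ≠ 0 := (hpos.trans_le (ha hi)).ne'
    calc _ ≤ (Finset.univ.filter fun i' => a i' = a i).card :=
          Finset.card_le_card (Finset.filter_subset_filter _ (Finset.subset_univ _))
      _ ≤ algMult T (a i) := hcard _ hi0
      _ = (F.filter fun j => s j = a i).card := (hs.card_filter hF (by exact_mod_cast hi0)).symm
      _ ≤ _ := by
        refine Finset.card_le_card fun j hj => ?_
        obtain ⟨hjF, hji⟩ := Finset.mem_filter.1 hj
        simp only [Finset.mem_filter, J]
        exact ⟨⟨hjF, i, hi, hji⟩, by simp [hji]⟩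
  rw [Fin.card_Iic] at hI
  omega

theorem IsEigenvalueSeq.hasEigenvalue {T : H →L[ℂ] H} {s : ℕ → ℂ} (hs : IsEigenvalueSeq T s)
    {k : ℕ} (hk : s k ≠ 0) : Module.End.HasEigenvalue (T : H →ₗ[ℂ] H) (s k) := by
  have h1 := hs.encard_eq (s k) hk
  have h2 : Module.End.HasUnifEigenvalue (T : H →ₗ[ℂ] H) (s k) ⊤ := by
    intro h0
    rw [algMult, Module.End.maxGenEigenspace, h0, finrank_bot, Nat.cast_zero,
      Set.encard_eq_zero] at h1
    exact (Set.eq_empty_iff_forall_notMem.1 h1 k) rfl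
  exact h2.lt zero_lt_one

/-! ### Singular values of the compression and the bound in terms of `‖z‖`. -/

section Complete

variable [CompleteSpace H]

/-- For an eigenvector `v`, `μ = ‖A v‖² / ‖v‖²`. This reconciles the real part in `singularValue`
with the modulus that orders the sequence. -/
theorem re_eq_norm_of_hasEigenvalue_adjoint_comp_self {A : H →L[ℂ] H} {μ : ℂ}
    (hμ : Module.End.HasEigenvalue
      ((ContinuousLinearMap.adjoint A ∘L A : H →L[ℂ] H) : H →ₗ[ℂ] H) μ) : μ.re = ‖μ‖ := by
  obtain ⟨v, hv⟩ := hμ.exists_hasEigenvector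
  have h1 : ContinuousLinearMap.adjoint A (A v) = μ • v := hv.apply_eq_smul
  have h2 : ((‖A v‖ ^ 2 : ℝ) : ℂ) = μ * ((‖v‖ ^ 2 : ℝ) : ℂ) := by
    have h3 := ContinuousLinearMap.adjoint_inner_right A v (A v)
    rw [h1, inner_smul_right, inner_self_eq_norm_sq_to_K, inner_self_eq_norm_sq_to_K] at h3
    push_cast
    exact h3.symm
  have hv0 : ‖v‖ ^ 2 ≠ 0 := pow_ne_zero 2 (norm_ne_zero_iff.2 hv.2)
  have h4 : μ = ((‖A v‖ ^ 2 / ‖v‖ ^ 2 : ℝ) : ℂ) := by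
    rw [Complex.ofReal_div, h2, mul_div_cancel_right₀ _ (by exact_mod_cast hv0)]
  rw [h4, Complex.ofReal_re, Complex.norm_real, Real.norm_of_nonneg (by positivity)]

theorem singularValues_restrict_le {A : H →L[ℂ] H} {V : Submodule ℂ H} [FiniteDimensional ℂ V]
    (hV : LinearMap.range (A : H →ₗ[ℂ] H) ≤ V)
    (hV' : LinearMap.range
      ((ContinuousLinearMap.adjoint A ∘L A : H →L[ℂ] H) : H →ₗ[ℂ] H) ≤ V) (k : ℕ) :
    ((A : H →ₗ[ℂ] H).restrict (mapsTo_of_range_le hV)).singularValues k ≤ singularValue A k := by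
  set f := (A : H →ₗ[ℂ] H).restrict (mapsTo_of_range_le hV) with hf
  set G := ContinuousLinearMap.adjoint A ∘L A with hG
  by_cases hk : k < finrank ℂ V
  swap
  · rw [f.singularValues_of_finrank_le (not_lt.1 hk)]
    exact Real.sqrt_nonneg _
  have := Submodule.finiteDimensional_of_le hV'
  have hs := isEigenvalueSeq_eigenvalueSeq G
  -- This is where `V` must be invariant under `A* A` as well as under `A`.
  have hfG : LinearMap.adjoint f ∘ₗ f = (G : H →ₗ[ℂ] H).restrict (mapsTo_of_range_le hV') := by
    refine LinearMap.ext fun y => ext_inner_left ℂ fun w => ?_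
    rw [LinearMap.comp_apply, LinearMap.adjoint_inner_right, Submodule.coe_inner,
      Submodule.coe_inner]
    exact (ContinuousLinearMap.adjoint_inner_right A (w : H) (A y)).symm
  rw [f.singularValues_of_lt rfl hk, singularValue]
  refine Real.sqrt_le_sqrt ?_
  have hle := hs.le_norm_of_card_le
    (f.isSymmetric_adjoint_comp_self.eigenvalues_antitone rfl) (fun α hα => ?_) ⟨k, hk⟩
  · by_cases h0 : eigenvalueSeq G k = 0
    · rw [h0, norm_zero] at hle
      rwa [h0, Complex.zero_re]
    · rwa [re_eq_norm_of_hasEigenvalue_adjoint_comp_self (hs.hasEigenvalue h0)]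
  · rw [algMult_eq_count_roots hV' (by exact_mod_cast hα), ← hfG, Polynomial.count_roots]
    -- Geometric multiplicity at most algebraic suffices, as only an upper bound is needed.
    refine le_trans (le_of_eq ?_) (LinearMap.finrank_eigenspace_le _ _)
    rw [← f.isSymmetric_adjoint_comp_self.card_filter_eigenvalues_eq rfl]
    congr 1
    ext i
    simp

theorem norm_detOneSub_inv_smul_le {A : H →L[ℂ] H} {n : ℕ}
    (hA : LinearMap.rank (A : H →ₗ[ℂ] H) = (n : Cardinal)) {z : ℂ} (hz : z ≠ 0) {x : H}
    (hx : ‖x‖ = 1) {δ : ℝ} (hxz : ‖z • x - A x‖ ≤ δ) :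
    ‖detOneSub (z⁻¹ • A)‖ ≤
      δ / ‖z‖ * ∏ k ∈ Finset.range n, (1 + singularValue A k / ‖z‖) := by
  set G := ContinuousLinearMap.adjoint A ∘L A with hG
  have hfinA : FiniteDimensional ℂ (LinearMap.range (A : H →ₗ[ℂ] H)) := by
    refine Module.rank_lt_aleph0_iff.1 ?_
    change LinearMap.rank (A : H →ₗ[ℂ] H) < _
    rw [hA]
    exact Cardinal.natCast_lt_aleph0
  let W := (LinearMap.range (A : H →ₗ[ℂ] H)).map (ContinuousLinearMap.adjoint A : H →ₗ[ℂ] H)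
  -- The three summands make `V` contain the range of `A`, the range of `A* A` and the test vector
  -- `x`.
  let V := LinearMap.range (A : H →ₗ[ℂ] H) ⊔ W ⊔ Submodule.span ℂ {x}
  have hV : LinearMap.range (A : H →ₗ[ℂ] H) ≤ V := le_sup_left.trans le_sup_left
  have hV' : LinearMap.range (G : H →ₗ[ℂ] H) ≤ V := by
    rintro _ ⟨y, rfl⟩
    exact (le_sup_right.trans le_sup_left : W ≤ V) ⟨A y, ⟨y, rfl⟩, rfl⟩
  have hVz : LinearMap.range ((z⁻¹ • A : H →L[ℂ] H) : H →ₗ[ℂ] H) ≤ V := by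
    rintro _ ⟨y, rfl⟩
    exact V.smul_mem _ (hV ⟨y, rfl⟩)
  have hxV : x ∈ V := (le_sup_right : _ ≤ V) (Submodule.mem_span_singleton_self x)
  set f := (A : H →ₗ[ℂ] H).restrict (mapsTo_of_range_le hV) with hf
  have hrank : finrank ℂ (LinearMap.range f) ≤ n := by
    have h1 : finrank ℂ (LinearMap.range (A : H →ₗ[ℂ] H)) = n := finrank_eq_of_rank_eq hA
    rw [← h1, ← Submodule.finrank_map_subtype_eq V]
    refine Submodule.finrank_mono ?_
    rintro _ ⟨_, ⟨y, rfl⟩, rfl⟩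
    exact ⟨y, rfl⟩
  have hδ : 0 ≤ δ := (norm_nonneg _).trans hxz
  rw [detOneSub_eq_det_restrict hVz]
  refine (LinearMap.norm_det_le_of_norm_le_add (T := f) (r := ‖z‖⁻¹) (δ := δ / ‖z‖) (by positivity)
    (fun y => ?_) (x := ⟨x, hxV⟩) hx ?_ hrank).trans ?_
  · change ‖(y : H) - z⁻¹ • A y‖ ≤ ‖(y : H)‖ + ‖z‖⁻¹ * ‖A y‖
    rw [← norm_inv, ← norm_smul]
    exact norm_sub_le _ _
  · change ‖x - z⁻¹ • A x‖ ≤ _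
    have h1 : x - z⁻¹ • A x = z⁻¹ • (z • x - A x) := by rw [smul_sub, inv_smul_smul₀ hz]
    rw [h1, norm_smul, norm_inv, div_eq_inv_mul]
    gcongr
  · refine mul_le_mul_of_nonneg_left (Finset.prod_le_prod (fun k _ => ?_) fun k _ => ?_)
      (by positivity)
    · have := f.singularValues_nonneg k
      positivity
    · rw [div_eq_inv_mul]
      have := singularValues_restrict_le hV hV' k
      gcongr

end Complete

/-- An invertible operator is onto, so its finite-dimensional range would be all of `H`. -/
theorem zero_mem_spectrum_of_finiteDimensional_range (hH : ¬ FiniteDimensional ℂ H)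
    (A : H →L[ℂ] H) [FiniteDimensional ℂ (LinearMap.range (A : H →ₗ[ℂ] H))] :
    (0 : ℂ) ∈ spectrum ℂ A := by
  rw [spectrum.zero_mem_iff]
  rintro ⟨u, rfl⟩
  apply hH
  have htop : LinearMap.range ((u : H →L[ℂ] H) : H →ₗ[ℂ] H) = ⊤ :=
    LinearMap.range_eq_top.2 fun y => ⟨(↑u⁻¹ : H →L[ℂ] H) y,
      congrArg (fun S : H →L[ℂ] H => S y) u.mul_inv⟩
  exact Module.finite_def.2 ((Submodule.fg_iff_finiteDimensional _).2 (htop ▸ ‹_›))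

end FiniteRankDet

theorem proposition3p2 {H : Type*} [NormedAddCommGroup H] [InnerProductSpace ℂ H]
    [CompleteSpace H] [TopologicalSpace.SeparableSpace H] (hH : ¬ FiniteDimensional ℂ H)
    (A B : H →L[ℂ] H) (n : ℕ) (hA : LinearMap.rank (A : H →ₗ[ℂ] H) = (n : Cardinal))
    (z : ℂ) (hzA : z ∈ resolventSet ℂ A)
    (hzB : Module.End.HasEigenvalue (B : H →ₗ[ℂ] H) z) :
    ‖FiniteRankDet.detOneSub (z⁻¹ • A)‖ ≤
      ‖A - B‖ / Metric.infDist z (spectrum ℂ A) *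
        ∏ k ∈ Finset.range n,
          (1 + FiniteRankDet.singularValue A k / Metric.infDist z (spectrum ℂ A)) := by
  have hfinA : FiniteDimensional ℂ (LinearMap.range (A : H →ₗ[ℂ] H)) := by
    refine Module.rank_lt_aleph0_iff.1 ?_
    change LinearMap.rank (A : H →ₗ[ℂ] H) < _
    rw [hA]
    exact Cardinal.natCast_lt_aleph0
  have h0 := FiniteRankDet.zero_mem_spectrum_of_finiteDimensional_range hH A
  have hzs : z ∉ spectrum ℂ A := fun h => h hzA
  have hz : z ≠ 0 := by
    rintro rfl
    exact hzs h0
  have hd : 0 < Metric.infDist z (spectrum ℂ A) :=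
    ((spectrum.isClosed A).notMem_iff_infDist_pos ⟨0, h0⟩).1 hzs
  have hdz : Metric.infDist z (spectrum ℂ A) ≤ ‖z‖ := by
    simpa using Metric.infDist_le_dist_of_mem (x := z) h0
  obtain ⟨v, hv⟩ := hzB.exists_hasEigenvector
  have hBv : B v = z • v := hv.apply_eq_smul
  have hx : ‖((‖v‖⁻¹ : ℝ) : ℂ) • v‖ = 1 := by
    rw [norm_smul, Complex.norm_real, norm_inv, norm_norm,
      inv_mul_cancel₀ (norm_ne_zero_iff.2 hv.2)]
  set x := ((‖v‖⁻¹ : ℝ) : ℂ) • v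
  have hBx : B x = z • x := by rw [map_smul, hBv, smul_comm]
  have hxz : ‖z • x - A x‖ ≤ ‖A - B‖ := by
    rw [← hBx, norm_sub_rev, ← sub_apply]
    simpa [hx] using (A - B).le_opNorm x
  have hs (k : ℕ) : 0 ≤ FiniteRankDet.singularValue A k := Real.sqrt_nonneg _
  refine (FiniteRankDet.norm_detOneSub_inv_smul_le hA hz hx hxz).trans ?_
  -- Each factor grows when `‖z‖` is replaced by the smaller distance to the spectrum.
  refine mul_le_mul (by gcongr) (Finset.prod_le_prod (fun k _ => ?_) fun k _ => ?_)
    (Finset.prod_nonneg fun k _ => ?_) (by positivity)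
  · have := hs k
    positivity
  · have := hs k
    gcongr
  · have := hs k
    positivity
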